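/- Let $G=(V,E)$ be a finite simple undirected graph with edge weights $w_e>0$, and let each edge carry an angle: for every edge $\{u,v\}$ let $\theta_{u\to v}\in\mathbb{R}$ be its angle when traversed from $u$ to $v$, with $\theta_{v\to u}=-\theta_{u\to v}$. Let $q_v>0$ for $v\in V$ and $Q=\mathrm{diag}(q_v)$. The magnetic Laplacian is the matrix $L=D-A_\theta\in\mathbb{C}^{V\times V}$, where $D$ is the diagonal matrix of the weighted degrees $\sum_{u:\{u,v\}\in E}w_{\{u,v\}}$ and $(A_\theta)_{v',v}=w_{e}\,e^{i\theta_{v\to v'}}$ if $e=\{v,v'\}\in E$, and $0$ otherwise. A rooted multi-type spanning forest $\phi$ of $G$ consists of a set $\phi_\bullet\subseteq E$ of edges and a set $\rho(\phi)\subseteq V$ of roots such that every connected component of the graph $(V,\phi_\bullet)$ is either a tree containing exactly one root, or a unicycle (a connected graph with exactly one cycle) containing no root. Let $\phi$ be a random rooted multi-type spanning forest with law $$\mathbb{P}(\phi)\ \propto\ \prod_{r\in\rho(\phi)}q_r\ \prod_{e\in\phi_\bullet}w_e\ \prod_{C}\bigl(2-2\cos\theta_C\bigr),$$ where $C$ runs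 over the cycles of the unicycles of $\phi$ and $\theta_C$ is the sum of the angles along $C$, traversed in either direction. Given $g\in\mathbb{C}^V$, define $\tilde f\in\mathbb{C}^V$ as follows. If the connected component of $v$ in $\phi$ is a rooted tree with root $r=r_\phi(v)$, then $\tilde f(v)=\psi_{r\to v}\,g(r)$, where $\psi_{r\to v}$ is the product of the phases $e^{i\theta_{a\to b}}$ over the steps $a\to b$ of the unique path from $r$ to $v$ in $\phi$; otherwise $\tilde f(v)=0$. Then $L+Q$ is invertible, and $\tilde f$ is an unbiased estimator of $f_o=(L+Q)^{-1}Qg$, that is, $\mathbb{E}_\phi(\tilde f)=f_o$. -/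

import Mathlib

open MeasureTheory ProbabilityTheory

namespace MagneticForest

noncomputable section

/-- A set `C` of edges of the graph `H` is a cycle: it is the edge set of a closed walk of `H`
without repeated edges or (interior) vertices. Cycles are thus counted without base point and
without orientation. -/
def IsCycleOf {V : Type*} [DecidableEq V] (H : SimpleGraph V) (C : Finset (Sym2 V)) : Prop :=
  ∃ (v : V) (p : H.Walk v v), p.IsCycle ∧ p.edges.toFinset = C

/-- The component `c` of `H` is a tree containing exactly one of the distinguished nodes `R`. -/
def IsRootedTree {V : Type*} (H : SimpleGraph V) (R : Finset V) (c : H.ConnectedComponent) :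
    Prop :=
  c.toSimpleGraph.IsTree ∧ ∃! r : V, r ∈ R ∧ r ∈ c.supp

/-- The component `c` of `H` contains exactly one cycle, and none of the distinguished
nodes `R`. -/
def IsUnicycle {V : Type*} [DecidableEq V] (H : SimpleGraph V) (R : Finset V)
    (c : H.ConnectedComponent) : Prop :=
  (∃! C : Finset (Sym2 V), ∃ (v : V) (p : H.Walk v v),
    v ∈ c.supp ∧ p.IsCycle ∧ p.edges.toFinset = C) ∧ ∀ r ∈ R, r ∉ c.supp

/-- A rooted multi-type spanning forest of `G`: a set of edges of `G` and a set of nodes (the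
roots) such that every connected component of the spanning subgraph with these edges is a tree
with exactly one root, or a unicycle (without root). -/
@[ext]
structure RootedMTSF {V : Type*} [DecidableEq V] (G : SimpleGraph V) where
  /-- the edges -/
  edges : Finset (Sym2 V)
  /-- the roots -/
  roots : Finset V
  edges_subset : ∀ e ∈ edges, e ∈ G.edgeSet
  component : ∀ c : (SimpleGraph.fromEdgeSet (edges : Set (Sym2 V))).ConnectedComponent,
    IsRootedTree _ roots c ∨ IsUnicycle _ roots c

/-- The spanning subgraph of `G` formed by all nodes and the edges of `φ`. -/
def RootedMTSF.graph {V : Type*} [DecidableEq V] {G : SimpleGraph V} (φ : RootedMTSF G) :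
    SimpleGraph V :=
  SimpleGraph.fromEdgeSet (φ.edges : Set (Sym2 V))

instance {V : Type*} [Fintype V] [DecidableEq V] (G : SimpleGraph V) :
    Finite (RootedMTSF G) :=
  Finite.of_injective (fun φ : RootedMTSF G => (φ.edges, φ.roots)) (by
    intro φ φ' h
    simp only [Prod.mk.injEq] at h
    exact RootedMTSF.ext h.1 h.2)

instance {V : Type*} [Fintype V] [DecidableEq V] (G : SimpleGraph V) :
    Fintype (RootedMTSF G) :=
  Fintype.ofFinite _

instance {V : Type*} [DecidableEq V] (G : SimpleGraph V) : MeasurableSpace (RootedMTSF G) := ⊤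

/-- The sum of the angles `θ` along an oriented walk; `θ u v` is the angle of the edge between
`u` and `v` when traversed from `u` to `v`. -/
def walkAngle {V : Type*} {H : SimpleGraph V} (θ : V → V → ℝ) {u v : V} (p : H.Walk u v) : ℝ :=
  (p.darts.map fun d => θ d.fst d.snd).sum

/-- The transport `ψ` along an oriented walk: the product of the phases `exp (i θ_e)`. -/
def transport {V : Type*} {H : SimpleGraph V} (θ : V → V → ℝ) {u v : V} (p : H.Walk u v) : ℂ :=
  (p.darts.map fun d => Complex.exp (Complex.I * (θ d.fst d.snd : ℂ))).prod

open Classical in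
/-- The angle `θ_C` of a cycle `C` of `H`, for some base point and orientation of `C`. For a
connection (`θ v u = - θ u v` on edges), another choice changes `θ_C` at most by a sign, so that
`cos θ_C` does not depend on the choice. -/
def cycleAngle {V : Type*} [DecidableEq V] (H : SimpleGraph V) (θ : V → V → ℝ)
    (C : Finset (Sym2 V)) : ℝ :=
  if h : IsCycleOf H C then walkAngle θ h.choose_spec.choose else 0

open Classical in
/-- The cycles of (the unicycles of) `φ`. -/
def RootedMTSF.cycles {V : Type*} [Fintype V] [DecidableEq V] {G : SimpleGraph V}
    (φ : RootedMTSF G) : Finset (Finset (Sym2 V)) :=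
  Finset.univ.filter fun C => IsCycleOf φ.graph C

/-- The unnormalized weight `∏ q_r ∏ w_e ∏ (2 - 2 cos θ_C)` of a rooted MTSF. -/
def weight {V : Type*} [Fintype V] [DecidableEq V] {G : SimpleGraph V} (w : Sym2 V → ℝ)
    (θ : V → V → ℝ) (q : V → ℝ) (φ : RootedMTSF G) : ℝ :=
  (∏ r ∈ φ.roots, q r) * (∏ e ∈ φ.edges, w e) *
    ∏ C ∈ φ.cycles, (2 - 2 * Real.cos (cycleAngle φ.graph θ C))

theorem weight_nonneg {V : Type*} [Fintype V] [DecidableEq V] {G : SimpleGraph V}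
    {w : Sym2 V → ℝ} (hw : ∀ e ∈ G.edgeSet, 0 < w e) (θ : V → V → ℝ)
    {q : V → ℝ} (hq : ∀ v, 0 < q v) (φ : RootedMTSF G) : 0 ≤ weight w θ q φ := by
  unfold weight
  refine mul_nonneg (mul_nonneg ?_ ?_) ?_
  · exact Finset.prod_nonneg fun r _ => (hq r).le
  · exact Finset.prod_nonneg fun e he => (hw e (φ.edges_subset e he)).le
  · refine Finset.prod_nonneg fun C _ => ?_
    linarith [Real.cos_le_one (cycleAngle φ.graph θ C)]

/-- The rooted MTSF without edges, all of whose nodes are roots. -/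
def allRoots {V : Type*} [Fintype V] [DecidableEq V] (G : SimpleGraph V) : RootedMTSF G where
  edges := ∅
  roots := Finset.univ
  edges_subset := by simp
  component := by
    intro c
    left
    have hbot : SimpleGraph.fromEdgeSet ((∅ : Finset (Sym2 V)) : Set (Sym2 V)) = ⊥ := by simp
    have hac : (SimpleGraph.fromEdgeSet ((∅ : Finset (Sym2 V)) : Set (Sym2 V))).IsAcyclic := by
      rw [hbot]; exact SimpleGraph.isAcyclic_bot
    refine ⟨hac.isTree_connectedComponent c, ?_⟩
    induction c using SimpleGraph.ConnectedComponent.ind with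
    | _ v =>
      refine ⟨v, ⟨Finset.mem_univ _, by simp⟩, ?_⟩
      rintro u ⟨-, hu⟩
      rw [SimpleGraph.ConnectedComponent.mem_supp_iff, SimpleGraph.ConnectedComponent.eq,
        hbot, SimpleGraph.reachable_bot] at hu
      exact hu

theorem weight_allRoots_pos {V : Type*} [Fintype V] [DecidableEq V] (G : SimpleGraph V)
    (w : Sym2 V → ℝ) (θ : V → V → ℝ) {q : V → ℝ} (hq : ∀ v, 0 < q v) :
    0 < weight w θ q (allRoots G) := by
  have hbot : (allRoots G).graph = ⊥ := by simp [RootedMTSF.graph, allRoots]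
  have hcyc : (allRoots G).cycles = ∅ := by
    classical
    refine Finset.eq_empty_of_forall_notMem fun C hC => ?_
    rw [RootedMTSF.cycles] at hC
    obtain ⟨v, p, hp, -⟩ := (Finset.mem_filter.1 hC).2
    exact (hbot ▸ SimpleGraph.isAcyclic_bot : (allRoots G).graph.IsAcyclic) p hp
  unfold weight
  rw [hcyc]
  simpa [allRoots] using Finset.prod_pos fun r (_ : r ∈ Finset.univ) => hq r

/-- The normalizing constant. -/
def partitionFunction {V : Type*} [Fintype V] [DecidableEq V] (G : SimpleGraph V)
    (w : Sym2 V → ℝ) (θ : V → V → ℝ) (q : V → ℝ) : ℝ :=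
  ∑ φ : RootedMTSF G, weight w θ q φ

theorem partitionFunction_pos {V : Type*} [Fintype V] [DecidableEq V] {G : SimpleGraph V}
    {w : Sym2 V → ℝ} (hw : ∀ e ∈ G.edgeSet, 0 < w e) (θ : V → V → ℝ)
    {q : V → ℝ} (hq : ∀ v, 0 < q v) : 0 < partitionFunction G w θ q :=
  Finset.sum_pos' (fun φ _ => weight_nonneg hw θ hq φ)
    ⟨allRoots G, Finset.mem_univ _, weight_allRoots_pos G w θ hq⟩

/-- The probability distribution on rooted MTSFs of `G` proportional to `weight`. -/
def law {V : Type*} [Fintype V] [DecidableEq V] {G : SimpleGraph V}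
    {w : Sym2 V → ℝ} (hw : ∀ e ∈ G.edgeSet, 0 < w e) (θ : V → V → ℝ)
    {q : V → ℝ} (hq : ∀ v, 0 < q v) : PMF (RootedMTSF G) :=
  PMF.ofFintype (fun φ => ENNReal.ofReal (weight w θ q φ / partitionFunction G w θ q)) (by
    have hZ := partitionFunction_pos hw θ hq
    rw [← ENNReal.ofReal_sum_of_nonneg
      (fun φ _ => div_nonneg (weight_nonneg hw θ hq φ) hZ.le), ← Finset.sum_div,
      ← partitionFunction, div_self hZ.ne', ENNReal.ofReal_one])

/-- If the component of `v` is a rooted tree, there is a path from its root to `v`. -/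
theorem exists_path_of_isRootedTree {V : Type*} {H : SimpleGraph V} {R : Finset V} {v : V}
    (h : IsRootedTree H R (H.connectedComponentMk v)) :
    ∃ p : H.Walk h.2.choose v, p.IsPath := by
  have hr := h.2.choose_spec.1.2
  rw [SimpleGraph.ConnectedComponent.mem_supp_iff, SimpleGraph.ConnectedComponent.eq] at hr
  exact hr.exists_isPath

open Classical in
/-- The estimator `f̃`: if the component of `v` in `φ` is a rooted tree, the value of `g` at the
(unique) root of this tree is transported to `v` along the (unique) path in `φ` from the root
to `v`; otherwise the value is `0`. -/
def estimator {V : Type*} [DecidableEq V] {G : SimpleGraph V} (θ : V → V → ℝ) (g : V → ℂ)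
    (φ : RootedMTSF G) (v : V) : ℂ :=
  if h : IsRootedTree φ.graph φ.roots (φ.graph.connectedComponentMk v) then
    transport θ (exists_path_of_isRootedTree h).choose * g h.2.choose
  else 0

open Classical in
/-- The weighted magnetic adjacency matrix: its entry at `(v', v)` is `w_e exp (i θ_e)` for an
edge `e` oriented from `v` to `v'`. -/
def magneticAdjacency {V : Type*} (G : SimpleGraph V) (w : Sym2 V → ℝ) (θ : V → V → ℝ) :
    Matrix V V ℂ :=
  Matrix.of fun v' v =>
    if G.Adj v v' then (w s(v, v') : ℂ) * Complex.exp (Complex.I * (θ v v' : ℂ)) else 0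

open Classical in
/-- The weighted degree matrix. -/
def degreeMatrix {V : Type*} [Fintype V] [DecidableEq V] (G : SimpleGraph V)
    (w : Sym2 V → ℝ) : Matrix V V ℂ :=
  Matrix.diagonal fun v => ∑ u : V, if G.Adj v u then (w s(v, u) : ℂ) else 0

/-- The magnetic Laplacian, i.e. the Hermitian matrix of the quadratic form
`f ↦ ∑ w_e |f v' - exp (i θ_e) f v|^2`, with `e` oriented from `v` to `v'`. -/
def magneticLaplacian {V : Type*} [Fintype V] [DecidableEq V] (G : SimpleGraph V)
    (w : Sym2 V → ℝ) (θ : V → V → ℝ) : Matrix V V ℂ :=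
  degreeMatrix G w - magneticAdjacency G w θ

end

end MagneticForest

/-! Write L + Q = C B, where B (`incidence`) has a row e_r for each node r and a row e_b - exp(iθ)
e_a for each edge, and C (`coincidence`) is its weighted adjoint (`coincidence_mul_incidence`). For
any matrix B' of the shape of B, Cauchy-Binet expands det(C B') over sets of |V| rows.

Only forests contribute: a nonzero term chooses injectively, for each node, the node itself or an
edge at it, and comparing the numbers of edges and nodes in each component shows that such a choice
is a rooted forest (`exists_rootedMTSF_of_injective`). Conversely, the roots and edges of a forest
are the range of an injective choice that points towards the roots or around the cycles
(`range_orient`, `orient_injective`). Together this gives `det_coincidence_mul_eq_sum`.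

For B' = B, orienting the forest φ makes its minor of B block triangular, up to unit phases of the
rows. Each cycle contributes 1 - exp(-iθ_C), with squared modulus 2 - 2 cos θ_C, and the other
blocks contribute 1 (`det_matrix`). So the term of φ is its weight, and det(L + Q) is the partition
function Z, which is positive.

By Cramer, the numerator of f_o(v) is det(C B'), where B' is B with column v replaced by (g, 0),
since C (g, 0) = Q g. On the rows of φ, the estimator solves B_φ f̃ = (g, 0): it equals g at the
roots and is parallel along the edges (`incidence_mulVec_estimator`). Hence the minor of B' is
det(B_φ) f̃(v), even when B_φ is singular. The numerator is thus the weighted sum of the f̃(v), and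
dividing by Z gives the expectation. -/

namespace MagneticForest

/-! ### Determinant expansions and a cyclic determinant. -/

section LinearAlgebra

variable {V X R : Type*} [Fintype V] [DecidableEq V] [Fintype X] [CommRing R]

/-- Expansion of the determinant of a product of rectangular matrices, by multilinearity in the
rows. -/
theorem det_mul_eq_sum (C : Matrix V X R) (B : Matrix X V R) :
    (C * B).det = ∑ f : V → X, (∏ v, C v (f v)) * (B.submatrix f id).det := by
  have h : (C * B) = fun v => ∑ x, C v x • B x := by
    ext v u
    simp [Matrix.mul_apply, Finset.sum_apply]
  rw [h]
  have h2 := (Matrix.detRowAlternating (n := V) (R := R)).toMultilinearMap.map_sum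
    (fun v (x : X) => C v x • B x)
  refine Eq.trans h2 (Finset.sum_congr rfl fun f _ => ?_)
  exact MultilinearMap.map_smul_univ _ (fun v => C v (f v)) (fun v => B (f v))

/-- The part of the expansion `det_mul_eq_sum` indexed by the maps into the range of `e`. -/
theorem sum_range_subset_eq_det_mul_det (C : Matrix V X R) (B : Matrix X V R) {e : V → X}
    (he : Function.Injective e) [DecidablePred fun f : V → X => ∀ v, f v ∈ Set.range e] :
    ∑ f : V → X with ∀ v, f v ∈ Set.range e, (∏ v, C v (f v)) * (B.submatrix f id).det =
      (C.submatrix id e).det * (B.submatrix e id).det := by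
  rw [← Matrix.det_mul, det_mul_eq_sum]
  symm
  refine Finset.sum_bij (fun σ _ => e ∘ σ) ?_ ?_ ?_ ?_
  · simp
  · intro σ _ τ _ h
    exact he.comp_left h
  · intro f hf
    choose σ hσ using (Finset.mem_filter.1 hf).2
    exact ⟨σ, Finset.mem_univ _, funext hσ⟩
  · intro σ _
    simp [Matrix.submatrix_submatrix]

/-- The determinant of the identity minus a weighted cyclic shift. -/
theorem det_one_sub_cyclic (n : ℕ) (p : ℕ → R) :
    (Matrix.of fun i j : Fin (n + 2) =>
      (if i = j then 1 else 0) - (if (j : ℕ) = (i + 1) % (n + 2) then p i else 0)).det =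
      1 - ∏ i ∈ Finset.range (n + 2), p i := by
  have hlt (i : Fin (n + 1)) : ((i : ℕ) + 1) % (n + 2) = i + 1 := Nat.mod_eq_of_lt (by omega)
  have h4 (x : Fin (n + 1)) : ((x : ℕ) + 1 + 1) % (n + 2) ≠ x + 1 := by
    intro h
    rcases Nat.lt_or_ge (x + 2) (n + 2) with hx | hx
    · rw [Nat.mod_eq_of_lt (by omega)] at h
      omega
    · rw [show (x : ℕ) + 1 + 1 = n + 2 by omega, Nat.mod_self] at h
      omega
  -- Column 0 is nonzero at most in the first and the last row. Deleting the first row leaves an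
  -- upper triangular minor with diagonal 1, deleting the last row a lower triangular one with
  -- diagonal -p i.
  rw [Matrix.det_succ_column_zero, Fin.sum_univ_succ, Fin.sum_univ_castSucc,
    Finset.sum_eq_zero, Matrix.det_of_isUpperTriangular, Matrix.det_of_isLowerTriangular]
  · have h2 : (0 : ℕ) = (n + 1 + 1) % (n + 2) := by simp
    have h3 (i : Fin (n + 1)) : i.castSucc ≠ i.succ := by simp [Fin.ext_iff]
    have h5 : (Fin.last n).succ = Fin.last (n + 1) := rfl
    have h6 : Fin.last (n + 1) ≠ 0 := Fin.last_pos.ne'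
    simp only [h5, Matrix.submatrix_apply, Matrix.of_apply, Fin.succAbove_last,
      Fin.succAbove_zero, Fin.val_succ, hlt, h3, h6, ← h2, Fin.val_castSucc, Fin.val_last,
      Fin.val_zero, if_true, if_false, (h4 _).symm, zero_sub, Finset.prod_neg,
      Finset.card_univ, Fintype.card_fin]
    rw [Finset.prod_range_succ, ← Fin.prod_univ_eq_prod_range]
    simp
    -- One sign is that of the cofactor, the other comes from the diagonal entries -p i.
    have : (-1 : R) ^ (n + 1) * (-1) ^ (n + 1) = 1 := by rw [← mul_pow]; simp
    linear_combination (-(p (n + 1)) * ∏ i : Fin (n + 1), p i) * this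
  · intro i j hij
    have hij : (i : ℕ) < j := hij
    have h1 : (i.castSucc : Fin (n + 2)) ≠ j.succ := by
      simp only [ne_eq, Fin.ext_iff, Fin.val_castSucc, Fin.val_succ]; omega
    have h2 : (j : ℕ) + 1 ≠ i + 1 := by omega
    have h5 : (Fin.last n).succ = Fin.last (n + 1) := rfl
    simp only [h5, Matrix.submatrix_apply, Matrix.of_apply, Fin.succAbove_last, Fin.val_succ, hlt,
      h1, h2, if_false, Fin.val_castSucc, sub_zero]
  · intro i j hij
    have hij : (j : ℕ) < i := hij
    have h1 : (i.succ : Fin (n + 2)) ≠ j.succ := by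
      simp only [ne_eq, Fin.ext_iff, Fin.val_succ]; omega
    have h2 : (j : ℕ) + 1 ≠ (i + 1 + 1) % (n + 2) := by
      rcases Nat.lt_or_ge (i + 2) (n + 2) with hx | hx
      · rw [Nat.mod_eq_of_lt (by omega)]
        omega
      · rw [show (i : ℕ) + 1 + 1 = n + 2 by omega, Nat.mod_self]
        omega
    simp only [Matrix.submatrix_apply, Matrix.of_apply, Fin.succAbove_zero, Fin.val_succ,
      h1, h2, if_false, sub_zero]
  · intro i _
    have h1 : (0 : ℕ) ≠ ((i : ℕ) + 1 + 1) % (n + 2) := by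
      rw [Nat.mod_eq_of_lt] <;> omega
    simp [h1]

end LinearAlgebra

/-! ### Factorization of L + Q through the magnetic incidence matrix. -/

noncomputable section

open Classical in
/-- The rows `e_r` of the nodes `r`, and the rows `e_b - exp (i θ_{a → b}) e_a` of the magnetic
incidence matrix, for the edges `{a, b}` of `G` with the orientation from `a` to `b` given by
`Quot.out`. -/
def incidence {V : Type*} (G : SimpleGraph V) (θ : V → V → ℝ) : Matrix (V ⊕ Sym2 V) V ℂ :=
  Matrix.of fun x v =>
    match x with
    | .inl r => if v = r then 1 else 0
    | .inr e =>
      if e ∈ G.edgeSet then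
        (if v = e.out.2 then 1 else 0) -
          Complex.exp (Complex.I * (θ e.out.1 e.out.2 : ℂ)) * (if v = e.out.1 then 1 else 0)
      else 0

/-- The adjoint of `incidence`, weighted by `q` and `w`. -/
def coincidence {V : Type*} (G : SimpleGraph V) (w : Sym2 V → ℝ) (θ : V → V → ℝ) (q : V → ℝ) :
    Matrix V (V ⊕ Sym2 V) ℂ :=
  Matrix.of fun v x => ((Sum.elim q w x : ℝ) : ℂ) * star (incidence G θ x v)

variable {V : Type*} {G : SimpleGraph V} {θ : V → V → ℝ}

theorem star_exp_mul_exp (t : ℝ) :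
    star (Complex.exp (Complex.I * t)) * Complex.exp (Complex.I * t) = 1 := by
  rw [Complex.star_def, ← Complex.exp_conj, ← Complex.exp_add]
  simp

theorem incidence_inl [DecidableEq V] (r v : V) :
    incidence G θ (.inl r) v = if v = r then 1 else 0 := by
  simp [incidence]

theorem incidence_inr_of_notMem {e : Sym2 V} (he : e ∉ G.edgeSet) (v : V) :
    incidence G θ (.inr e) v = 0 := by
  simp [incidence, he]

/-- The row of an edge does not depend on its orientation, up to a phase. -/
theorem exists_incidence_inr_eq [DecidableEq V] (hθ : ∀ u v, G.Adj u v → θ v u = -θ u v) {u v : V}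
    (h : G.Adj u v) : ∃ κ : ℂ, star κ * κ = 1 ∧ ∀ x, incidence G θ (.inr s(u, v)) x =
      κ * ((if x = v then 1 else 0) -
        Complex.exp (Complex.I * (θ u v : ℂ)) * (if x = u then 1 else 0)) := by
  have hout : s((s(u, v)).out.1, (s(u, v)).out.2) = s(u, v) := Quot.out_eq _
  have hmem : s(u, v) ∈ G.edgeSet := h
  rcases Sym2.eq_iff.1 hout with ⟨h1, h2⟩ | ⟨h1, h2⟩
  · refine ⟨1, by simp, fun x => ?_⟩
    simp [incidence, h1, h2, h]
  · refine ⟨-Complex.exp (Complex.I * (θ v u : ℂ)), ?_, fun x => ?_⟩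
    · simpa using star_exp_mul_exp (θ v u)
    · simp only [incidence, Matrix.of_apply, hmem, if_true, h1, h2]
      have : Complex.exp (Complex.I * (θ v u : ℂ)) * Complex.exp (Complex.I * (θ u v : ℂ)) = 1 := by
        rw [← Complex.exp_add, hθ u v h]
        simp
      linear_combination (-(if x = u then 1 else 0)) * this

theorem incidence_inr_ne_zero {e : Sym2 V} {v : V} (h : incidence G θ (.inr e) v ≠ 0) :
    e ∈ G.edgeSet ∧ v ∈ e := by
  classical
  have he : e ∈ G.edgeSet := by
    by_contra he
    exact h (incidence_inr_of_notMem he v)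
  refine ⟨he, ?_⟩
  by_contra hv
  have hout : s(e.out.1, e.out.2) = e := Quot.out_eq _
  rw [← hout, Sym2.mem_iff, not_or] at hv
  exact h (by simp [incidence, hv.1, hv.2])

/-- The node rows produce Q and the edge rows produce L. The unknown orientation of an edge row
enters only through a phase κ, which cancels against its conjugate. -/
theorem coincidence_mul_incidence [Fintype V] [DecidableEq V] (w : Sym2 V → ℝ) (q : V → ℝ)
    (hθ : ∀ u v, G.Adj u v → θ v u = -θ u v) :
    coincidence G w θ q * incidence G θ =
      magneticLaplacian G w θ + Matrix.diagonal fun v => (q v : ℂ) := by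
  classical
  ext a b
  rw [Matrix.mul_apply, Fintype.sum_sum_type, Matrix.add_apply, add_comm]
  congr 1
  · rcases eq_or_ne a b with rfl | hab
    · have h1 : magneticLaplacian G w θ a a = ∑ u : V, if G.Adj a u then (w s(a, u) : ℂ) else 0 := by
        simp [magneticLaplacian, degreeMatrix, magneticAdjacency]
      rw [h1, ← Finset.sum_filter]
      symm
      refine Finset.sum_of_injOn (fun u => s(a, u)) ?_ ?_ ?_ ?_
      · intro u _ v _ huv
        exact Sym2.congr_right.1 huv
      · simp
      · intro e _ he
        by_contra h
        have h2 : incidence G θ (.inr e) a ≠ 0 := fun h0 => h (by simp [h0])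
        obtain ⟨he1, u, rfl⟩ := incidence_inr_ne_zero h2
        exact he ⟨u, by simpa using he1, rfl⟩
      · intro u hu
        have hau : G.Adj a u := by simpa using hu
        -- Orienting the edge from `u` to `a` makes the coefficient at `a` just κ.
        obtain ⟨κ, hκ, hr⟩ := exists_incidence_inr_eq hθ hau.symm
        rw [coincidence, Matrix.of_apply, Sym2.eq_swap, hr]
        simp only [Sum.elim_inr, hau.ne, if_true, if_false, mul_zero, sub_zero, mul_one]
        linear_combination (-(w s(u, a) : ℂ)) * hκ
    · have h1 : magneticLaplacian G w θ a b = if G.Adj b a then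
          -((w s(b, a) : ℂ) * Complex.exp (Complex.I * (θ b a : ℂ))) else 0 := by
        simp [magneticLaplacian, degreeMatrix, magneticAdjacency, hab]
        split_ifs <;> simp
      rw [h1, Finset.sum_eq_single s(b, a)]
      · split_ifs with hba
        · obtain ⟨κ, hκ, hr⟩ := exists_incidence_inr_eq hθ hba
          rw [coincidence, Matrix.of_apply, hr, hr]
          simp only [Sum.elim_inr, hab, hab.symm, if_true, if_false, mul_zero, sub_zero, mul_one, zero_sub]
          linear_combination
            (-(w s(b, a) : ℂ) * Complex.exp (Complex.I * (θ b a : ℂ))) * hκ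
        · rw [incidence_inr_of_notMem (by simpa using hba), mul_zero]
      · intro e _ he
        by_contra h
        have h2 : incidence G θ (.inr e) b ≠ 0 := fun h0 => h (by simp [h0])
        have h3 : incidence G θ (.inr e) a ≠ 0 := fun h0 => h (by simp [coincidence, h0])
        exact he ((Sym2.mem_and_mem_iff hab.symm).1
          ⟨(incidence_inr_ne_zero h2).2, (incidence_inr_ne_zero h3).2⟩)
      · simp
  · simp only [coincidence, Matrix.of_apply, incidence_inl, Sum.elim_inl, Matrix.diagonal_apply]
    simp
    split_ifs with h <;> simp [h]

end

/-! ### Edge counts, and forests from injective choices. -/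

/-- In a connected graph with at most as many edges as nodes, there is at most one cycle. -/
theorem edges_subset_of_isCycle {W : Type*} [Finite W] {T : SimpleGraph W} (hT : T.Connected)
    (hcard : Nat.card T.edgeSet ≤ Nat.card W) {u v : W} {p : T.Walk u u} {r : T.Walk v v}
    (hp : p.IsCycle) (hr : r.IsCycle) : p.edges ⊆ r.edges := by
  intro e he
  by_contra her
  have hbr : ¬ T.IsBridge e := fun h => h.notMem_edges_of_isCycle hp he
  have heT : e ∈ T.edgeSet := p.edges_subset_edgeSet he
  -- An edge on `p` is not a bridge, so deleting it keeps the graph connected with fewer edges than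
  -- nodes, hence a tree. But `r` avoids `e` and survives as a cycle.
  have hconn : (T.deleteEdges {e}).Connected := by
    induction e with
    | _ x y => exact hT.connected_delete_edge_of_not_isBridge hbr
  have hlt : Nat.card (T.deleteEdges {e}).edgeSet < Nat.card T.edgeSet := by
    rw [Nat.card_coe_set_eq, Nat.card_coe_set_eq]
    refine Set.ncard_lt_ncard ?_ (Set.toFinite _)
    rw [SimpleGraph.edgeSet_deleteEdges]
    exact ⟨Set.sdiff_subset, fun h => (h heT).2 rfl⟩
  have hle := hconn.card_vert_le_card_edgeSet_add_one
  have htree : (T.deleteEdges {e}).IsTree :=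
    SimpleGraph.isTree_iff_connected_and_card.2 ⟨hconn, by omega⟩
  exact htree.isAcyclic (r.toDeleteEdge e her) (hr.transfer _)

/-- A walk never leaves its component. This moves cycles to `c.toSimpleGraph`, where acyclicity and
edge counts are available. -/
theorem exists_isCycle_toSimpleGraph {V : Type*} [DecidableEq V] {H : SimpleGraph V} (c : H.ConnectedComponent)
    {v : V} (hv : v ∈ c.supp) {p : H.Walk v v} (hp : p.IsCycle) :
    ∃ (x : c) (r : c.toSimpleGraph.Walk x x), r.IsCycle ∧
      p.edges = r.edges.map (Sym2.map Subtype.val) := by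
  have hsupp : ∀ x ∈ p.support, x ∈ c.supp := by
    intro x hx
    rw [SimpleGraph.ConnectedComponent.mem_supp_iff] at hv ⊢
    rw [← hv, SimpleGraph.ConnectedComponent.eq]
    exact (p.takeUntil x hx).reachable.symm
  have hmap := p.map_induce hsupp
  refine ⟨⟨v, hv⟩, p.induce c.supp hsupp, ?_, ?_⟩
  · rw [← hmap] at hp
    exact hp.of_map
  · exact (congrArg SimpleGraph.Walk.edges hmap).symm.trans (SimpleGraph.Walk.edges_map _ _)

/-- The component `c` has at most one cycle if it has at most as many edges as nodes. -/
theorem existsUnique_cycle {V : Type*} [Fintype V] [DecidableEq V] {H : SimpleGraph V}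
    (c : H.ConnectedComponent) (hcard : Nat.card c.toSimpleGraph.edgeSet = Nat.card c) :
    ∃! C : Finset (Sym2 V), ∃ (v : V) (p : H.Walk v v),
      v ∈ c.supp ∧ p.IsCycle ∧ p.edges.toFinset = C := by
  have hconn := c.connected_toSimpleGraph
  have hac : ¬ c.toSimpleGraph.IsAcyclic := fun h => by
    have := (SimpleGraph.isTree_iff_connected_and_card.1 ⟨hconn, h⟩).2
    omega
  simp only [SimpleGraph.IsAcyclic, not_forall, not_not] at hac
  obtain ⟨x, r, hr⟩ := hac
  refine ⟨_, ⟨x, r.map c.toSimpleGraph_hom, x.2, hr.map Subtype.val_injective, rfl⟩, ?_⟩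
  rintro _ ⟨v, p, hv, hp, rfl⟩
  obtain ⟨y, s, hs, hps⟩ := exists_isCycle_toSimpleGraph c hv hp
  have h1 := edges_subset_of_isCycle hconn hcard.le hs hr
  have h2 := edges_subset_of_isCycle hconn hcard.le hr hs
  have hr' : SimpleGraph.Walk.edges (G := H) (r.map c.toSimpleGraph_hom) =
      r.edges.map (Sym2.map Subtype.val) := SimpleGraph.Walk.edges_map _ _
  rw [hps]
  refine Eq.trans ?_ (congrArg List.toFinset hr').symm
  ext e
  simp only [List.mem_toFinset, List.mem_map]
  exact ⟨fun ⟨a, ha, h⟩ => ⟨a, h1 ha, h⟩, fun ⟨a, ha, h⟩ => ⟨a, h2 ha, h⟩⟩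

/-- An injective choice, for each node `v`, of `v` itself or of an edge of `G` at `v`, is
a rooted multi-type spanning forest. -/
theorem exists_rootedMTSF_of_injective {V : Type*} [Fintype V] [DecidableEq V] {G : SimpleGraph V}
    {f : V → V ⊕ Sym2 V} (hf : Function.Injective f) (hroot : ∀ v r, f v = .inl r → r = v)
    (hedge : ∀ v e, f v = .inr e → e ∈ G.edgeSet ∧ v ∈ e) :
    ∃ φ : RootedMTSF G, φ.roots.disjSum φ.edges = Finset.univ.image f := by
  classical
  set S := Finset.univ.image f with hS
  have hR : ∀ r, r ∈ S.toLeft ↔ f r = .inl r := by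
    intro r
    simp only [Finset.mem_toLeft, hS, Finset.mem_image, Finset.mem_univ, true_and]
    exact ⟨fun ⟨v, hv⟩ => by rwa [← hroot v r hv] at hv, fun h => ⟨r, h⟩⟩
  have hE : ∀ e, e ∈ S.toRight ↔ ∃ v, f v = .inr e := by
    simp [hS]
  set H := SimpleGraph.fromEdgeSet (S.toRight : Set (Sym2 V)) with hH
  refine ⟨⟨S.toRight, S.toLeft, ?_, ?_⟩, Finset.toLeft_disjSum_toRight⟩
  · intro e he
    obtain ⟨v, hv⟩ := (hE e).1 he
    exact (hedge v e hv).1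
  intro c
  have hedgeSet : ∀ e, e ∈ H.edgeSet ↔ e ∈ S.toRight := by
    intro e
    rw [hH, SimpleGraph.edgeSet_fromEdgeSet, Set.mem_sdiff, Finset.mem_coe, and_iff_left_iff_imp]
    intro he
    obtain ⟨v, hv⟩ := (hE e).1 he
    exact G.not_isDiag_of_mem_edgeSet (hedge v e hv).1
  have hmem : ∀ e : c.toSimpleGraph.edgeSet, ∃ v : c, f v = .inr (Sym2.map Subtype.val e.1) := by
    rintro ⟨e, he⟩
    induction e with
    | _ x y =>
      have hxy : H.Adj x y := he
      obtain ⟨v, hv⟩ := (hE _).1 ((hedgeSet s(x.1, y.1)).1 hxy)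
      have := (hedge v _ hv).2
      rcases Sym2.mem_iff.1 this with rfl | rfl
      · exact ⟨x, hv⟩
      · exact ⟨y, hv⟩
  choose a ha using hmem
  -- Edges and roots of `c` inject into its nodes, by the node choosing them. As connectedness gives
  -- at least |c| - 1 edges, there is at most one root, and with a root the component is a tree.
  have hcard : Nat.card c.toSimpleGraph.edgeSet + Nat.card {v : c // f v = .inl v.1} ≤
      Nat.card c := by
    rw [← Nat.card_sum]
    refine Nat.card_le_card_of_injective (Sum.elim a Subtype.val) ?_
    refine Function.Injective.sumElim ?_ Subtype.val_injective ?_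
    · intro e e' h
      have h1 := ha e
      rw [h, ha e'] at h1
      exact Subtype.ext (Sym2.map.injective Subtype.val_injective (Sum.inr.inj h1)).symm
    · intro e v h
      have h1 := ha e
      rw [h, v.2] at h1
      cases h1
  have hconn := c.connected_toSimpleGraph
  have hle := hconn.card_vert_le_card_edgeSet_add_one
  by_cases hr : ∃ v : c, f v = .inl v.1
  · left
    have : Nonempty {v : c // f v = .inl v.1} := by
      obtain ⟨v, hv⟩ := hr
      exact ⟨⟨v, hv⟩⟩
    have hpos : 0 < Nat.card {v : c // f v = .inl v.1} := Nat.card_pos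
    refine ⟨SimpleGraph.isTree_iff_connected_and_card.2 ⟨hconn, by omega⟩, ?_⟩
    have hsub : Subsingleton {v : c // f v = .inl v.1} :=
      Finite.card_le_one_iff_subsingleton.1 (by omega)
    obtain ⟨v, hv⟩ := hr
    refine ⟨v, ⟨(hR _).2 hv, v.2⟩, ?_⟩
    rintro u ⟨hu, huc⟩
    have := hsub.elim ⟨⟨u, huc⟩, (hR _).1 hu⟩ ⟨v, hv⟩
    simpa [Subtype.ext_iff] using this
  · right
    push Not at hr
    refine ⟨existsUnique_cycle c ?_, fun r hrR hrc => hr ⟨r, hrc⟩ ((hR r).1 hrR)⟩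
    refine le_antisymm (by omega) ?_
    -- Without a root, every node chooses an edge of `c`, which gives the reverse inequality.
    have hmem2 : ∀ v : c, ∃ e : c.toSimpleGraph.edgeSet, f v = .inr (Sym2.map Subtype.val e.1) := by
      intro v
      rcases hfv : f v with r | e
      · exact absurd (by rw [hfv, hroot v r hfv]) (hr v)
      · obtain ⟨u, rfl⟩ := (hedge v e hfv).2
        have hadj : H.Adj v u := (hedgeSet _).2 ((hE _).2 ⟨v, hfv⟩)
        exact ⟨⟨s(v, ⟨u, c.mem_supp_of_adj_mem_supp v.2 hadj⟩), hadj⟩, rfl⟩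
    choose b hb using hmem2
    refine Nat.card_le_card_of_injective b fun v v' h => ?_
    have h1 := hb v
    rw [h, ← hb v'] at h1
    exact Subtype.ext (hf h1)

/-! ### The estimator as solution of the linear system of a forest. -/

theorem transport_append {V : Type*} {H : SimpleGraph V} (θ : V → V → ℝ) {u v x : V}
    (p : H.Walk u v) (r : H.Walk v x) :
    transport θ (p.append r) = transport θ p * transport θ r := by
  simp [transport]

theorem transport_concat {V : Type*} {H : SimpleGraph V} (θ : V → V → ℝ) {u v x : V}
    (p : H.Walk u v) (h : H.Adj v x) :
    transport θ (p.concat h) = transport θ p * Complex.exp (Complex.I * (θ v x : ℂ)) := by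
  simp [transport]

/-- Paths in a component without cycles are determined by their end points. -/
theorem path_eq_of_isAcyclic {V : Type*} {H : SimpleGraph V} {c : H.ConnectedComponent}
    (hc : c.toSimpleGraph.IsAcyclic) {u v : V} (hu : u ∈ c.supp) {p r : H.Walk u v}
    (hp : p.IsPath) (hr : r.IsPath) : p = r := by
  classical
  have hsupp : ∀ s : H.Walk u v, ∀ x ∈ s.support, x ∈ c.supp := by
    intro s x hx
    rw [SimpleGraph.ConnectedComponent.mem_supp_iff] at hu ⊢
    rw [← hu, SimpleGraph.ConnectedComponent.eq]
    exact (s.takeUntil x hx).reachable.symm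
  have hp' : (p.induce c.supp (hsupp p)).IsPath := by
    have := p.map_induce (hsupp p)
    rw [← this] at hp
    exact hp.of_map
  have hr' : (r.induce c.supp (hsupp r)).IsPath := by
    have := r.map_induce (hsupp r)
    rw [← this] at hr
    exact hr.of_map
  have h := congrArg Subtype.val ((SimpleGraph.IsAcyclic.subsingleton_path (G := H.induce c.supp) hc
    _ _).elim ⟨_, hp'⟩ ⟨_, hr'⟩)
  rw [← p.map_induce (hsupp p), ← r.map_induce (hsupp r)]
  exact congrArg (SimpleGraph.Walk.map (SimpleGraph.Embedding.induce c.supp).toHom) h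

section

variable {V : Type*} [DecidableEq V] {G : SimpleGraph V}

/-- Frees the estimator from its choices: root and path are unique in a rooted tree. -/
theorem estimator_eq_of_isPath (θ : V → V → ℝ) (g : V → ℂ) (φ : RootedMTSF G) {r v : V}
    (h : IsRootedTree φ.graph φ.roots (φ.graph.connectedComponentMk v)) (hr : r ∈ φ.roots)
    {p : φ.graph.Walk r v} (hp : p.IsPath) : estimator θ g φ v = transport θ p * g r := by
  have hrv : r ∈ (φ.graph.connectedComponentMk v).supp := by
    rw [SimpleGraph.ConnectedComponent.mem_supp_iff, SimpleGraph.ConnectedComponent.eq]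
    exact p.reachable
  have hroot : h.2.choose = r := h.2.unique h.2.choose_spec.1 ⟨hr, hrv⟩
  rw [estimator, dif_pos h]
  have hp' := (exists_path_of_isRootedTree h).choose_spec
  -- The chosen root occurs in the type of the chosen path, so the path must be abstracted first.
  generalize (exists_path_of_isRootedTree h).choose = p' at hp'
  generalize h.2.choose = r' at p' hroot
  subst hroot
  rw [path_eq_of_isAcyclic h.1.isAcyclic hrv hp' hp]

theorem isRootedTree_of_mem_roots (φ : RootedMTSF G) {r : V} (hr : r ∈ φ.roots)
    (c : φ.graph.ConnectedComponent) (hrc : r ∈ c.supp) : IsRootedTree φ.graph φ.roots c :=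
  (φ.component c).resolve_right fun h => h.2 r hr hrc

theorem estimator_root (θ : V → V → ℝ) (g : V → ℂ) (φ : RootedMTSF G) {r : V}
    (hr : r ∈ φ.roots) : estimator θ g φ r = g r := by
  rw [estimator_eq_of_isPath θ g φ (isRootedTree_of_mem_roots φ hr _ rfl) hr
    SimpleGraph.Walk.IsPath.nil]
  simp [transport]

theorem RootedMTSF.graph_adj (φ : RootedMTSF G) {u v : V} :
    φ.graph.Adj u v ↔ s(u, v) ∈ φ.edges := by
  rw [RootedMTSF.graph, SimpleGraph.fromEdgeSet_adj, Finset.mem_coe, and_iff_left_iff_imp]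
  intro h
  exact SimpleGraph.Adj.ne (G := G) (φ.edges_subset _ h)

theorem RootedMTSF.graph_le (φ : RootedMTSF G) : φ.graph ≤ G := by
  intro u v h
  exact φ.edges_subset _ (φ.graph_adj.1 h)

theorem estimator_adj {θ : V → V → ℝ} (hθ : ∀ u v, G.Adj u v → θ v u = -θ u v) (g : V → ℂ)
    (φ : RootedMTSF G) {u v : V} (h : φ.graph.Adj u v) :
    estimator θ g φ v = Complex.exp (Complex.I * (θ u v : ℂ)) * estimator θ g φ u := by
  have hc : φ.graph.connectedComponentMk u = φ.graph.connectedComponentMk v :=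
    SimpleGraph.ConnectedComponent.eq.2 h.reachable
  by_cases hv : IsRootedTree φ.graph φ.roots (φ.graph.connectedComponentMk v)
  · have hu := hv
    rw [← hc] at hu
    obtain ⟨r, ⟨hr, hru⟩, -⟩ := hu.2
    have hreach : φ.graph.Reachable r u := SimpleGraph.ConnectedComponent.eq.1 hru
    obtain ⟨p, hp⟩ := hreach.exists_isPath
    rw [estimator_eq_of_isPath θ g φ hu hr hp]
    -- Either the path from the root to `u` ends with the step from `v` to `u`, or it extends by the
    -- edge to a path to `v`.
    by_cases hvp : v ∈ p.support
    · have hrest : p.dropUntil v hvp = h.symm.toWalk :=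
        path_eq_of_isAcyclic (c := φ.graph.connectedComponentMk v) hv.1.isAcyclic rfl
          (hp.dropUntil hvp) (SimpleGraph.Walk.IsPath.of_adj h.symm)
      rw [estimator_eq_of_isPath θ g φ hv hr (hp.takeUntil hvp)]
      conv_rhs => rw [← p.take_spec hvp, hrest, transport_append]
      have h1 : transport θ h.symm.toWalk = Complex.exp (Complex.I * (θ v u : ℂ)) := by
        simp [transport]
      have h2 : Complex.exp (Complex.I * (θ u v : ℂ)) * Complex.exp (Complex.I * (θ v u : ℂ)) =
          1 := by
        rw [← Complex.exp_add, hθ u v (φ.graph_le h)]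
        simp
      rw [h1]
      linear_combination (-(transport θ (p.takeUntil v hvp) * g r)) * h2
    · rw [estimator_eq_of_isPath θ g φ hv hr (hp.concat hvp h), transport_concat]
      ring
  · rw [estimator, dif_neg hv, estimator, dif_neg (by rwa [hc]), mul_zero]

/-- The estimator solves the linear system given by the rows of its forest. -/
theorem incidence_mulVec_estimator [Fintype V] {θ : V → V → ℝ}
    (hθ : ∀ u v, G.Adj u v → θ v u = -θ u v) (g : V → ℂ) (φ : RootedMTSF G) {x : V ⊕ Sym2 V}
    (hx : x ∈ φ.roots.disjSum φ.edges) :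
    (incidence G θ).mulVec (estimator θ g φ) x = Sum.elim g 0 x := by
  rcases x with r | e
  · have hr : r ∈ φ.roots := by simpa using hx
    simp [Matrix.mulVec, dotProduct, incidence_inl, estimator_root θ g φ hr]
  · have he : e ∈ φ.edges := by simpa using hx
    induction e with
    | _ u v =>
      have hadj : φ.graph.Adj u v := φ.graph_adj.2 he
      obtain ⟨κ, -, hκ⟩ := exists_incidence_inr_eq hθ (φ.graph_le hadj)
      simp only [Matrix.mulVec, dotProduct, hκ, mul_assoc, sub_mul, ← Finset.mul_sum,
        Finset.sum_sub_distrib, ite_mul, one_mul, zero_mul, Finset.sum_ite_eq', Finset.mem_univ,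
        if_true, Sum.elim_inr, Pi.zero_apply, estimator_adj hθ g φ hadj, sub_self, mul_zero]

end

/-! ### Orientation of a forest towards its roots and around its cycles. -/

noncomputable section

/-- The base point of the closed walk along the cycle `C` which defines `cycleAngle`. -/
def cycleBase {V : Type*} [DecidableEq V] {H : SimpleGraph V} {C : Finset (Sym2 V)}
    (hC : IsCycleOf H C) : V :=
  hC.choose

/-- The closed walk along the cycle `C` which defines `cycleAngle`. -/
def cycleWalk {V : Type*} [DecidableEq V] {H : SimpleGraph V} {C : Finset (Sym2 V)}
    (hC : IsCycleOf H C) : H.Walk (cycleBase hC) (cycleBase hC) :=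
  hC.choose_spec.choose

theorem isCycle_cycleWalk {V : Type*} [DecidableEq V] {H : SimpleGraph V} {C : Finset (Sym2 V)}
    (hC : IsCycleOf H C) : (cycleWalk hC).IsCycle :=
  hC.choose_spec.choose_spec.1

theorem edges_cycleWalk {V : Type*} [DecidableEq V] {H : SimpleGraph V} {C : Finset (Sym2 V)}
    (hC : IsCycleOf H C) : (cycleWalk hC).edges.toFinset = C :=
  hC.choose_spec.choose_spec.2

theorem cycleAngle_eq {V : Type*} [DecidableEq V] {H : SimpleGraph V} (θ : V → V → ℝ)
    {C : Finset (Sym2 V)} (hC : IsCycleOf H C) :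
    cycleAngle H θ C = walkAngle θ (cycleWalk hC) := by
  rw [cycleAngle, dif_pos hC]
  rfl

theorem connectedComponentMk_eq_of_mem_support {V : Type*} {H : SimpleGraph V} {u v x : V}
    {p : H.Walk u v} (hx : x ∈ p.support) :
    H.connectedComponentMk x = H.connectedComponentMk u := by
  classical
  exact SimpleGraph.ConnectedComponent.eq.2 (p.takeUntil x hx).reachable.symm

theorem mem_edges_iff_exists_getVert {V : Type*} {H : SimpleGraph V} {u v : V} {p : H.Walk u v}
    {e : Sym2 V} : e ∈ p.edges ↔ ∃ i < p.length, s(p.getVert i, p.getVert (i + 1)) = e := by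
  rw [List.mem_iff_getElem]
  simp [SimpleGraph.Walk.getElem_edges]

variable {V : Type*} [DecidableEq V] {G : SimpleGraph V} (φ : RootedMTSF G)

theorem isUnicycle_of_isCycle {c : φ.graph.ConnectedComponent} {v : V} (hv : v ∈ c.supp)
    {p : φ.graph.Walk v v} (hp : p.IsCycle) : IsUnicycle φ.graph φ.roots c := by
  refine (φ.component c).resolve_left fun h => ?_
  obtain ⟨x, r, hr, -⟩ := exists_isCycle_toSimpleGraph c hv hp
  exact h.1.isAcyclic r hr

/-- Each component contains at most one cycle. -/
theorem eq_of_isCycleOf {C C' : Finset (Sym2 V)} (hC : IsCycleOf φ.graph C)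
    (hC' : IsCycleOf φ.graph C')
    (h : φ.graph.connectedComponentMk (cycleBase hC) =
      φ.graph.connectedComponentMk (cycleBase hC')) : C = C' :=
  (isUnicycle_of_isCycle φ rfl (isCycle_cycleWalk hC)).1.unique
    ⟨_, _, rfl, isCycle_cycleWalk hC, edges_cycleWalk hC⟩
    ⟨_, _, h.symm, isCycle_cycleWalk hC', edges_cycleWalk hC'⟩

/-- The component of a cycle has no root. -/
theorem connectedComponentMk_ne_of_mem_roots {C : Finset (Sym2 V)} (hC : IsCycleOf φ.graph C)
    {r : V} (hr : r ∈ φ.roots) :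
    φ.graph.connectedComponentMk r ≠ φ.graph.connectedComponentMk (cycleBase hC) :=
  (isUnicycle_of_isCycle φ rfl (isCycle_cycleWalk hC)).2 r hr

theorem eq_of_mem_roots {r r' : V} (hr : r ∈ φ.roots) (hr' : r' ∈ φ.roots)
    (h : φ.graph.connectedComponentMk r = φ.graph.connectedComponentMk r') : r = r' :=
  (isRootedTree_of_mem_roots φ hr _ rfl).2.unique ⟨hr, rfl⟩ ⟨hr', h.symm⟩

/-- The core consists of the roots and of the nodes of the cycles. -/
def RootedMTSF.core : Set V :=
  {v | v ∈ φ.roots ∨ ∃ (C : _) (hC : IsCycleOf φ.graph C), v ∈ (cycleWalk hC).support}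

theorem exists_walk_to_core (v : V) :
    ∃ n, ∃ k ∈ φ.core, ∃ p : φ.graph.Walk v k, p.length = n := by
  suffices ∃ k ∈ φ.core, φ.graph.Reachable v k by
    obtain ⟨k, hk, ⟨p⟩⟩ := this
    exact ⟨_, k, hk, p, rfl⟩
  rcases φ.component (φ.graph.connectedComponentMk v) with h | h
  · obtain ⟨r, ⟨hr, hrv⟩, -⟩ := h.2
    exact ⟨r, Or.inl hr, (SimpleGraph.ConnectedComponent.eq.1 hrv).symm⟩
  · obtain ⟨C, ⟨u, p, hu, hp, hpC⟩, -⟩ := h.1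
    have hC : IsCycleOf φ.graph C := ⟨u, p, hp, hpC⟩
    have hlen := hp.three_le_length
    -- The chosen walk along `C` may start elsewhere than `p`, but it has the same edges, hence
    -- passes through the base point of `p`.
    have he : s(p.getVert 0, p.getVert 1) ∈ (cycleWalk hC).edges := by
      rw [← List.mem_toFinset, edges_cycleWalk hC, ← hpC, List.mem_toFinset,
        mem_edges_iff_exists_getVert]
      exact ⟨0, by omega, rfl⟩
    refine ⟨p.getVert 0, Or.inr ⟨C, hC, SimpleGraph.Walk.fst_mem_support_of_mem_edges _ he⟩, ?_⟩
    rw [SimpleGraph.Walk.getVert_zero]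
    exact (SimpleGraph.ConnectedComponent.eq.1 hu).symm

open Classical in
/-- The distance of a node to the core. -/
def RootedMTSF.height (v : V) : ℕ :=
  Nat.find (exists_walk_to_core φ v)

theorem height_eq_zero_iff {v : V} : φ.height v = 0 ↔ v ∈ φ.core := by
  classical
  rw [RootedMTSF.height, Nat.find_eq_zero]
  constructor
  · rintro ⟨k, hk, p, hp⟩
    rwa [SimpleGraph.Walk.eq_of_length_eq_zero hp]
  · intro h
    exact ⟨v, h, .nil, rfl⟩

theorem exists_adj_height_lt {v : V} (hv : φ.height v ≠ 0) :
    ∃ u, φ.graph.Adj v u ∧ φ.height u < φ.height v := by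
  classical
  obtain ⟨k, hk, p, hp⟩ := Nat.find_spec (exists_walk_to_core φ v)
  change p.length = φ.height v at hp
  cases p with
  | nil => exact absurd hp.symm hv
  | cons h p' =>
    refine ⟨_, h, ?_⟩
    rw [← hp, SimpleGraph.Walk.length_cons, Nat.lt_succ_iff]
    exact Nat.find_min' _ ⟨k, hk, p', rfl⟩

/-- The two requirements never compete: cycle nodes have height 0. On a cycle the successor is well
determined, since a component has only one cycle and the indices below the length list its nodes
without repetition. -/
theorem exists_successor (v : V) : ∃ u,
    (φ.height v ≠ 0 → φ.graph.Adj v u ∧ φ.height u < φ.height v) ∧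
    ∀ (C : _) (hC : IsCycleOf φ.graph C), ∀ i < (cycleWalk hC).length,
      (cycleWalk hC).getVert i = v → u = (cycleWalk hC).getVert (i + 1) := by
  by_cases hv : φ.height v = 0
  · by_cases h : ∃ (C : _) (hC : IsCycleOf φ.graph C),
      ∃ i < (cycleWalk hC).length, (cycleWalk hC).getVert i = v
    · obtain ⟨C, hC, i, hi, hiv⟩ := h
      refine ⟨(cycleWalk hC).getVert (i + 1), fun h => absurd hv h, fun C' hC' j hj hjv => ?_⟩
      · have hCC : C = C' := by
          refine eq_of_isCycleOf φ hC hC' ?_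
          rw [← connectedComponentMk_eq_of_mem_support ((cycleWalk hC).getVert_mem_support i),
            ← connectedComponentMk_eq_of_mem_support ((cycleWalk hC').getVert_mem_support j),
            hiv, hjv]
        subst hCC
        have hij : i = j := (isCycle_cycleWalk hC).getVert_injOn' (Nat.le_sub_one_of_lt hi)
          (Nat.le_sub_one_of_lt hj) (hiv.trans hjv.symm)
        rw [hij]
    · exact ⟨v, fun h => absurd hv h, fun C hC i hi hiv => absurd ⟨C, hC, i, hi, hiv⟩ h⟩
  · obtain ⟨u, hu⟩ := exists_adj_height_lt φ hv
    refine ⟨u, fun _ => hu, fun C hC i hi hiv => absurd ((height_eq_zero_iff φ).2 ?_) hv⟩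
    exact Or.inr ⟨C, hC, hiv ▸ (cycleWalk hC).getVert_mem_support i⟩

/-- The next node on the way to the core or, on a cycle, along the cycle. -/
def RootedMTSF.next (v : V) : V :=
  (exists_successor φ v).choose

theorem next_of_height_ne_zero {v : V} (hv : φ.height v ≠ 0) :
    φ.graph.Adj v (φ.next v) ∧ φ.height (φ.next v) < φ.height v :=
  (exists_successor φ v).choose_spec.1 hv

theorem next_getVert {C : Finset (Sym2 V)} (hC : IsCycleOf φ.graph C) {i : ℕ}
    (hi : i < (cycleWalk hC).length) :
    φ.next ((cycleWalk hC).getVert i) = (cycleWalk hC).getVert (i + 1) :=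
  (exists_successor φ _).choose_spec.2 C hC i hi rfl

theorem exists_getVert_eq {H : SimpleGraph V} {C : Finset (Sym2 V)} (hC : IsCycleOf H C) {v : V}
    (hv : v ∈ (cycleWalk hC).support) :
    ∃ i < (cycleWalk hC).length, (cycleWalk hC).getVert i = v := by
  obtain ⟨i, hi, hle⟩ := SimpleGraph.Walk.mem_support_iff_exists_getVert.1 hv
  have hlen := (isCycle_cycleWalk hC).three_le_length
  rcases hle.lt_or_eq with h | h
  · exact ⟨i, h, hi⟩
  · refine ⟨0, by omega, ?_⟩
    rw [← hi, h, SimpleGraph.Walk.getVert_zero, SimpleGraph.Walk.getVert_length]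

/-- Outside of the roots, a core node is on a cycle. -/
theorem exists_getVert_of_height_eq_zero {v : V} (hv : v ∉ φ.roots) (h : φ.height v = 0) :
    ∃ (C : _) (hC : IsCycleOf φ.graph C), ∃ i < (cycleWalk hC).length,
      (cycleWalk hC).getVert i = v := by
  obtain ⟨C, hC, hvC⟩ := ((height_eq_zero_iff φ).1 h).resolve_left hv
  exact ⟨C, hC, exists_getVert_eq hC hvC⟩

theorem height_getVert {C : Finset (Sym2 V)} (hC : IsCycleOf φ.graph C) (i : ℕ) :
    φ.height ((cycleWalk hC).getVert i) = 0 :=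
  (height_eq_zero_iff φ).2 (Or.inr ⟨C, hC, (cycleWalk hC).getVert_mem_support i⟩)

theorem height_next_of_eq_zero {v : V} (hv : v ∉ φ.roots) (h : φ.height v = 0) :
    φ.height (φ.next v) = 0 := by
  obtain ⟨C, hC, i, hi, rfl⟩ := exists_getVert_of_height_eq_zero φ hv h
  rw [next_getVert φ hC hi]
  exact height_getVert φ hC _

theorem adj_next {v : V} (hv : v ∉ φ.roots) : φ.graph.Adj v (φ.next v) := by
  by_cases h : φ.height v = 0
  · obtain ⟨C, hC, i, hi, rfl⟩ := exists_getVert_of_height_eq_zero φ hv h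
    rw [next_getVert φ hC hi]
    exact (cycleWalk hC).adj_getVert_succ hi
  · exact (next_of_height_ne_zero φ h).1

/-- The map from a node to itself, if it is a root, and to the edge towards the next node,
otherwise. -/
def RootedMTSF.orient (v : V) : V ⊕ Sym2 V :=
  if v ∈ φ.roots then .inl v else .inr s(v, φ.next v)

theorem orient_mem (v : V) : φ.orient v ∈ φ.roots.disjSum φ.edges := by
  rw [RootedMTSF.orient]
  split_ifs with h
  · simpa using h
  · simpa using φ.graph_adj.1 (adj_next φ h)

/-- Off the core the height drops and non-root core nodes move within the core, so a return after
two steps could only occur on a cycle, whose length is at least 3. This is what makes `orient`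
injective on edges. -/
theorem next_next_ne {v : V} (hv : v ∉ φ.roots) (hv' : φ.next v ∉ φ.roots) :
    φ.next (φ.next v) ≠ v := by
  intro h
  by_cases h0 : φ.height v = 0
  · obtain ⟨C, hC, i, hi, rfl⟩ := exists_getVert_of_height_eq_zero φ hv h0
    rw [next_getVert φ hC hi] at h
    have hcyc := isCycle_cycleWalk hC
    have hlen := hcyc.three_le_length
    rcases Nat.lt_or_ge (i + 1) (cycleWalk hC).length with h1 | h1
    · rw [next_getVert φ hC h1] at h
      have := hcyc.getVert_sub_one_ne_getVert_add_one (i := i + 1) h1.le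
      exact this h.symm
    -- Here `i` is the last index, and the next node is again the base point.
    · have h2 : (cycleWalk hC).getVert (i + 1) = (cycleWalk hC).getVert 0 := by
        rw [SimpleGraph.Walk.getVert_of_length_le _ h1, SimpleGraph.Walk.getVert_zero]
      rw [h2, next_getVert φ hC (by omega)] at h
      have := hcyc.getVert_injOn' (x₁ := 0 + 1) (x₂ := i)
        (show 0 + 1 ≤ _ by omega) (show i ≤ _ by omega) h
      omega
  · have h1 := next_of_height_ne_zero φ h0
    by_cases h2 : φ.height (φ.next v) = 0
    · have := height_next_of_eq_zero φ hv' h2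
      rw [h] at this
      exact h0 this
    · have h3 := next_of_height_ne_zero φ h2
      rw [h] at h3
      omega

theorem orient_injective : Function.Injective φ.orient := by
  intro u v h
  rw [RootedMTSF.orient, RootedMTSF.orient] at h
  split_ifs at h with hu hv hv
  · exact Sum.inl.inj h
  · rcases Sym2.eq_iff.1 (Sum.inr.inj h) with ⟨h1, -⟩ | ⟨h1, h2⟩
    · exact h1
    · subst h1
      exact absurd h2 (next_next_ne φ hv hu)

/-- After deletion of an edge which is not of the form `s(v, φ.next v)`, each node is still
connected to the core. -/
theorem exists_core_reachable_deleteEdges {e : Sym2 V}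
    (he : ∀ v, v ∉ φ.roots → s(v, φ.next v) ≠ e) (v : V) :
    ∃ k ∈ φ.core, (φ.graph.deleteEdges {e}).Reachable v k := by
  induction hn : φ.height v using Nat.strong_induction_on generalizing v with
  | _ n ih =>
    by_cases h0 : φ.height v = 0
    · exact ⟨v, (height_eq_zero_iff φ).1 h0, .rfl⟩
    · have hv : v ∉ φ.roots := fun hv => h0 ((height_eq_zero_iff φ).2 (Or.inl hv))
      have h1 := next_of_height_ne_zero φ h0
      obtain ⟨k, hk, hvk⟩ := ih _ (hn ▸ h1.2) (φ.next v) rfl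
      have hadj : (φ.graph.deleteEdges {e}).Adj v (φ.next v) := by
        rw [SimpleGraph.deleteEdges_adj]
        exact ⟨h1.1, he v hv⟩
      exact ⟨k, hk, hadj.reachable.trans hvk⟩

theorem getVert_notMem_roots {C : Finset (Sym2 V)} (hC : IsCycleOf φ.graph C) (i : ℕ) :
    (cycleWalk hC).getVert i ∉ φ.roots := fun h =>
  connectedComponentMk_ne_of_mem_roots φ hC h
    (connectedComponentMk_eq_of_mem_support ((cycleWalk hC).getVert_mem_support i))

theorem notMem_edges_cycleWalk {e : Sym2 V} (he : ∀ v, v ∉ φ.roots → s(v, φ.next v) ≠ e)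
    {C : Finset (Sym2 V)} (hC : IsCycleOf φ.graph C) : e ∉ (cycleWalk hC).edges := by
  intro h
  obtain ⟨i, hi, rfl⟩ := mem_edges_iff_exists_getVert.1 h
  rw [← next_getVert φ hC hi] at he
  exact he _ (getVert_notMem_roots φ hC i) rfl

/-- If `e` were never used, deleting it would leave both ends connected to the core, and the core of
each component connected. So `e` would lie on a cycle, but all cycle edges are used. -/
theorem exists_next_eq {e : Sym2 V} (he : e ∈ φ.edges) :
    ∃ v, v ∉ φ.roots ∧ s(v, φ.next v) = e := by
  by_contra! hne
  have hcore : ∀ k ∈ φ.core, ∀ k' ∈ φ.core,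
      φ.graph.connectedComponentMk k = φ.graph.connectedComponentMk k' →
      (φ.graph.deleteEdges {e}).Reachable k k' := by
    intro k hk k' hk' h
    rcases hk with hk | ⟨C, hC, hk⟩ <;> rcases hk' with hk' | ⟨C', hC', hk'⟩
    · rw [eq_of_mem_roots φ hk hk' h]
    · exact absurd (h.trans (connectedComponentMk_eq_of_mem_support hk'))
        (connectedComponentMk_ne_of_mem_roots φ hC' hk)
    · exact absurd (h.symm.trans (connectedComponentMk_eq_of_mem_support hk))
        (connectedComponentMk_ne_of_mem_roots φ hC hk')
    · have hCC : C = C' := eq_of_isCycleOf φ hC hC'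
        ((connectedComponentMk_eq_of_mem_support hk).symm.trans
          (h.trans (connectedComponentMk_eq_of_mem_support hk')))
      subst hCC
      set p := (cycleWalk hC).toDeleteEdge e (notMem_edges_cycleWalk φ hne hC)
      have hsupp : p.support = (cycleWalk hC).support := SimpleGraph.Walk.support_transfer _ _
      rw [← hsupp] at hk hk'
      exact (p.takeUntil k hk).reachable.symm.trans (p.takeUntil k' hk').reachable
  induction e with
  | _ a b =>
    have hab : φ.graph.Adj a b := φ.graph_adj.2 he
    obtain ⟨k, hk, hak⟩ := exists_core_reachable_deleteEdges φ hne a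
    obtain ⟨k', hk', hbk⟩ := exists_core_reachable_deleteEdges φ hne b
    have hle := SimpleGraph.deleteEdges_le (G := φ.graph) {s(a, b)}
    have hkk : φ.graph.connectedComponentMk k = φ.graph.connectedComponentMk k' :=
      SimpleGraph.ConnectedComponent.eq.2
        ((hak.mono hle).symm.trans (hab.reachable.trans (hbk.mono hle)))
    obtain ⟨u, p, hp, hep⟩ := SimpleGraph.adj_and_reachable_delete_edges_iff_exists_cycle.1
      ⟨hab, hak.trans ((hcore k hk k' hk' hkk).trans hbk.symm)⟩
    have hC : IsCycleOf φ.graph p.edges.toFinset := ⟨u, p, hp, rfl⟩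
    refine notMem_edges_cycleWalk φ hne hC ?_
    rwa [← List.mem_toFinset, edges_cycleWalk hC, List.mem_toFinset]

theorem range_orient : Set.range φ.orient = φ.roots.disjSum φ.edges := by
  ext x
  constructor
  · rintro ⟨v, rfl⟩
    exact orient_mem φ v
  · intro hx
    rcases x with r | e
    · have hr : r ∈ φ.roots := by simpa using hx
      exact ⟨r, by simp [RootedMTSF.orient, hr]⟩
    · obtain ⟨v, hv, rfl⟩ := exists_next_eq φ (e := e) (by simpa using hx)
      exact ⟨v, by simp [RootedMTSF.orient, hv]⟩

end

/-! ### The minors belonging to a forest. -/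

noncomputable section

theorem walkAngle_eq_sum {V : Type*} {H : SimpleGraph V} (θ : V → V → ℝ) {u v : V}
    (p : H.Walk u v) :
    walkAngle θ p = ∑ i ∈ Finset.range p.length, θ (p.getVert i) (p.getVert (i + 1)) := by
  induction p with
  | nil => simp [walkAngle]
  | cons h p ih =>
    rw [SimpleGraph.Walk.length_cons, Finset.sum_range_succ']
    simp only [SimpleGraph.Walk.getVert_cons_succ, ← ih]
    simp [walkAngle, add_comm]

theorem star_one_sub_exp_mul (α : ℝ) :
    star (1 - Complex.exp (-(Complex.I * α))) * (1 - Complex.exp (-(Complex.I * α))) =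
      ((2 - 2 * Real.cos α : ℝ) : ℂ) := by
  have h1 : star (Complex.exp (-(Complex.I * α))) = Complex.exp (Complex.I * α) := by
    rw [Complex.star_def, ← Complex.exp_conj]
    simp
  have h2 : Complex.exp (Complex.I * α) * Complex.exp (-(Complex.I * α)) = 1 := by
    rw [← Complex.exp_add]
    simp
  rw [star_sub, star_one, h1]
  push_cast
  rw [Complex.cos]
  rw [show (α : ℂ) * Complex.I = Complex.I * α by ring,
    show -(α : ℂ) * Complex.I = -(Complex.I * α) by ring]
  linear_combination h2

variable {V : Type*} [DecidableEq V] {G : SimpleGraph V} (φ : RootedMTSF G)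

/-- The matrix with rows `e_v` for the roots `v` and `e_v - exp (i θ_{u → v}) e_u` for the other
nodes `v`, with `u` next to `v`. -/
def RootedMTSF.matrix (θ : V → V → ℝ) : Matrix V V ℂ :=
  Matrix.of fun i j => (if i = j then 1 else 0) -
    if i ∉ φ.roots ∧ j = φ.next i then Complex.exp (Complex.I * (θ (φ.next i) i : ℂ)) else 0

theorem connectedComponentMk_next {v : V} (hv : v ∉ φ.roots) :
    φ.graph.connectedComponentMk (φ.next v) = φ.graph.connectedComponentMk v :=
  SimpleGraph.ConnectedComponent.eq.2 (adj_next φ hv).symm.reachable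

theorem height_next_le {v : V} (hv : v ∉ φ.roots) : φ.height (φ.next v) ≤ φ.height v := by
  by_cases h : φ.height v = 0
  · rw [height_next_of_eq_zero φ hv h, h]
  · exact (next_of_height_ne_zero φ h).2.le

variable [Fintype V]

/-- The rows of the two matrices differ by unit phases, which the squared modulus of the determinant
does not see. -/
theorem det_submatrix_orient {θ : V → V → ℝ} (hθ : ∀ u v, G.Adj u v → θ v u = -θ u v) :
    star ((incidence G θ).submatrix φ.orient id).det *
        ((incidence G θ).submatrix φ.orient id).det =
      star (φ.matrix θ).det * (φ.matrix θ).det := by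
  have hrow : ∀ i, ∃ κ : ℂ, star κ * κ = 1 ∧
      ∀ j, incidence G θ (φ.orient i) j = κ * φ.matrix θ i j := by
    intro i
    by_cases hi : i ∈ φ.roots
    · refine ⟨1, by simp, fun j => ?_⟩
      simp [RootedMTSF.orient, hi, incidence_inl, RootedMTSF.matrix, eq_comm]
    · obtain ⟨κ, hκ, h⟩ := exists_incidence_inr_eq hθ (φ.graph_le (adj_next φ hi)).symm
      refine ⟨κ, hκ, fun j => ?_⟩
      rw [RootedMTSF.orient, if_neg hi, Sym2.eq_swap, h]
      simp [RootedMTSF.matrix, hi, eq_comm]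
  choose κ hκ hrow using hrow
  have h : (incidence G θ).submatrix φ.orient id =
      Matrix.of fun i j => κ i * φ.matrix θ i j := by
    ext i j
    exact hrow i j
  rw [h, Matrix.det_mul_column, star_mul', star_prod]
  have h1 : (∏ i, star (κ i)) * ∏ i, κ i = 1 := by
    rw [← Finset.prod_mul_distrib]
    exact Finset.prod_eq_one fun i _ => hκ i
  linear_combination (star (φ.matrix θ).det * (φ.matrix θ).det) * h1

/-- The block of a cycle. -/
theorem det_block_cycle {θ : V → V → ℝ} (hθ : ∀ u v, G.Adj u v → θ v u = -θ u v)
    {C : Finset (Sym2 V)} (hC : IsCycleOf φ.graph C) {p : V → Prop} [DecidablePred p]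
    (hp : ∀ v, p v ↔ v ∈ (cycleWalk hC).support) :
    ((φ.matrix θ).toSquareBlockProp p).det =
      1 - Complex.exp (-(Complex.I * (cycleAngle φ.graph θ C : ℂ))) := by
  set r := cycleWalk hC with hr
  have hcyc : r.IsCycle := isCycle_cycleWalk hC
  obtain ⟨n, hn⟩ : ∃ n, r.length = n + 2 := ⟨r.length - 2, by have := hcyc.three_le_length; omega⟩
  let e : Fin (n + 2) ≃ {v // p v} := Equiv.ofBijective
    (fun i => ⟨r.getVert i, (hp _).2 (r.getVert_mem_support _)⟩) (by
      constructor
      · intro i j h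
        have := hcyc.getVert_injOn' (x₁ := (i : ℕ)) (x₂ := (j : ℕ)) (show _ ≤ _ - 1 by omega)
          (show _ ≤ _ - 1 by omega) (Subtype.ext_iff.1 h)
        exact Fin.ext this
      · rintro ⟨v, hv⟩
        obtain ⟨i, hi, rfl⟩ := exists_getVert_eq hC ((hp v).1 hv)
        exact ⟨⟨i, hn ▸ hi⟩, rfl⟩)
  have he : ∀ i, (e i : V) = r.getVert i := fun i => rfl
  have hnext : ∀ i : Fin (n + 2), φ.next (r.getVert i) = r.getVert (i + 1) := fun i =>
    next_getVert φ hC (by rw [← hr, hn]; exact i.2)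
  -- These phases run against the direction of the walk, hence the minus sign in front of the cycle
  -- angle.
  let ph : ℕ → ℂ := fun i => Complex.exp (Complex.I * (θ (r.getVert (i + 1)) (r.getVert i) : ℂ))
  rw [← Matrix.det_submatrix_equiv_self e]
  have hM : ((φ.matrix θ).toSquareBlockProp p).submatrix e e = Matrix.of fun i j : Fin (n + 2) =>
      (if i = j then 1 else 0) - (if (j : ℕ) = (i + 1) % (n + 2) then ph i else 0) := by
    ext i j
    have h1 : r.getVert i = e j ↔ i = j := by rw [← he, Subtype.val_inj, e.injective.eq_iff]
    have h2 : r.getVert (i + 1) = r.getVert ((i + 1) % (n + 2)) := by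
      rcases Nat.lt_or_ge ((i : ℕ) + 1) (n + 2) with h | h
      · rw [Nat.mod_eq_of_lt h]
      · rw [show (i : ℕ) + 1 = n + 2 by omega, Nat.mod_self, ← hn, SimpleGraph.Walk.getVert_length,
          SimpleGraph.Walk.getVert_zero]
    have h4 : (e j : V) = r.getVert (i + 1) ↔ (j : ℕ) = (i + 1) % (n + 2) := by
      rw [h2]
      have := he ⟨(i + 1) % (n + 2), Nat.mod_lt _ (by omega)⟩
      simp only at this
      rw [← this, Subtype.val_inj, e.injective.eq_iff, Fin.ext_iff]
    have h5 : r.getVert i ∉ φ.roots := getVert_notMem_roots φ hC i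
    simp only [Matrix.submatrix_apply, Matrix.toSquareBlockProp_def, Matrix.of_apply,
      RootedMTSF.matrix, h1, he i, hnext, h4, h5, not_false_eq_true, true_and, ph]
  rw [hM, det_one_sub_cyclic n ph, ← Complex.exp_sum, cycleAngle_eq θ hC, walkAngle_eq_sum, ← hr, hn]
  congr 2
  push_cast
  rw [Finset.mul_sum, ← Finset.sum_neg_distrib]
  refine Finset.sum_congr rfl fun i hi => ?_
  have hadj : φ.graph.Adj _ _ := r.adj_getVert_succ (by rw [hn]; exact Finset.mem_range.1 hi)
  rw [hθ _ _ (φ.graph_le hadj)]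
  push_cast
  ring

/-- Off the cycles, the blocks are trivial. -/
theorem det_block_eq_one (θ : V → V → ℝ) {p : V → Prop} [DecidablePred p]
    (hp : ∀ v, p v → v ∉ φ.roots → ¬ p (φ.next v)) :
    ((φ.matrix θ).toSquareBlockProp p).det = 1 := by
  have : (φ.matrix θ).toSquareBlockProp p = 1 := by
    ext i j
    have h : ¬ ((i : V) ∉ φ.roots ∧ (j : V) = φ.next i) := fun h =>
      hp i i.2 h.1 (h.2 ▸ j.2)
    simp only [Matrix.toSquareBlockProp_def, Matrix.of_apply, RootedMTSF.matrix, if_neg h, sub_zero,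
      Matrix.one_apply, Subtype.val_inj]
  rw [this, Matrix.det_one]

/-- Passing to the next node keeps the component and never raises the height, so the matrix is block
triangular for the pair (height, component). The nodes of each cycle form one block; any other block
contains no step to a next node and is an identity matrix. -/
theorem det_matrix {θ : V → V → ℝ} (hθ : ∀ u v, G.Adj u v → θ v u = -θ u v) :
    (φ.matrix θ).det =
      ∏ C ∈ φ.cycles, (1 - Complex.exp (-(Complex.I * (cycleAngle φ.graph θ C : ℂ)))) := by
  classical
  -- Any order on the components will do; it only serves to order the block labels linearly.
  let _ : LinearOrder φ.graph.ConnectedComponent := linearOrderOfSTO WellOrderingRel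
  let b : V → (ℕ ×ₗ φ.graph.ConnectedComponent)ᵒᵈ := fun v =>
    OrderDual.toDual (toLex (φ.height v, φ.graph.connectedComponentMk v))
  have hb : ∀ u v, b u = b v ↔ φ.height u = φ.height v ∧
      φ.graph.connectedComponentMk u = φ.graph.connectedComponentMk v := by
    simp [b]
  have htri : (φ.matrix θ).BlockTriangular b := by
    intro i j hij
    have hne : i ≠ j := by
      rintro rfl
      exact lt_irrefl _ hij
    have h : ¬ (i ∉ φ.roots ∧ j = φ.next i) := by
      rintro ⟨hi, rfl⟩
      refine absurd hij (not_lt.2 ?_)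
      change toLex (φ.height (φ.next i), φ.graph.connectedComponentMk (φ.next i)) ≤
        toLex (φ.height i, φ.graph.connectedComponentMk i)
      rw [connectedComponentMk_next φ hi, Prod.Lex.toLex_le_toLex]
      rcases (height_next_le φ hi).lt_or_eq with h | h
      · exact Or.inl h
      · exact Or.inr ⟨h, le_rfl⟩
    simp only [RootedMTSF.matrix, Matrix.of_apply, if_neg h, if_neg hne, sub_zero]
  have hcyc : ∀ C ∈ φ.cycles, IsCycleOf φ.graph C := fun C hC => (Finset.mem_filter.1 hC).2
  have hsupp : ∀ {C} (hC : IsCycleOf φ.graph C) (v : V),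
      b v = b (cycleBase hC) ↔ v ∈ (cycleWalk hC).support := by
    intro C hC v
    have h0 : φ.height (cycleBase hC) = 0 := by
      have := height_getVert φ hC 0
      rwa [SimpleGraph.Walk.getVert_zero] at this
    rw [hb, h0]
    constructor
    · rintro ⟨h1, h2⟩
      have hv : v ∉ φ.roots := fun hv => connectedComponentMk_ne_of_mem_roots φ hC hv h2
      obtain ⟨C', hC', i, hi, rfl⟩ := exists_getVert_of_height_eq_zero φ hv h1
      have hCC : C = C' := eq_of_isCycleOf φ hC hC' (h2.symm.trans
        (connectedComponentMk_eq_of_mem_support ((cycleWalk hC').getVert_mem_support i)))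
      subst hCC
      exact (cycleWalk hC).getVert_mem_support i
    · intro hv
      exact ⟨(height_eq_zero_iff φ).2 (Or.inr ⟨C, hC, hv⟩),
        connectedComponentMk_eq_of_mem_support hv⟩
  rw [htri.det, ← Finset.prod_attach φ.cycles]
  symm
  refine Finset.prod_of_injOn (fun C => b (cycleBase (hcyc C.1 C.2))) ?_ ?_ ?_ ?_
  · intro C _ C' _ h
    exact Subtype.ext (eq_of_isCycleOf φ _ _ ((hb _ _).1 h).2)
  · intro C _
    simp
  · intro a ha hne
    obtain ⟨u, -, rfl⟩ := Finset.mem_image.1 ha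
    refine det_block_eq_one φ θ fun v hv hvr hnext => ?_
    have h0 : φ.height v = 0 := by
      by_contra h0
      have := (next_of_height_ne_zero φ h0).2
      have h1 := ((hb _ _).1 (hnext.trans hv.symm)).1
      omega
    obtain ⟨C, hC, i, hi, rfl⟩ := exists_getVert_of_height_eq_zero φ hvr h0
    refine hne ⟨⟨C, Finset.mem_filter.2 ⟨Finset.mem_univ _, hC⟩⟩, Finset.mem_coe.2
      (Finset.mem_attach _ _), ?_⟩
    exact ((hsupp hC _).2 ((cycleWalk hC).getVert_mem_support i)).symm.trans hv
  · intro C _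
    exact (det_block_cycle φ hθ (hcyc C.1 C.2) (hsupp _)).symm

/-- The weight of a forest is the product of its minors of `coincidence` and `incidence`. -/
theorem det_mul_det_eq_weight {w : Sym2 V → ℝ} {θ : V → V → ℝ} {q : V → ℝ}
    (hθ : ∀ u v, G.Adj u v → θ v u = -θ u v) :
    ((coincidence G w θ q).submatrix id φ.orient).det *
        ((incidence G θ).submatrix φ.orient id).det = (weight w θ q φ : ℂ) := by
  have h1 : (coincidence G w θ q).submatrix id φ.orient =
      Matrix.of fun i j => ((Sum.elim q w (φ.orient j) : ℝ) : ℂ) *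
        ((incidence G θ).submatrix φ.orient id).conjTranspose i j := by
    ext i j
    simp [coincidence]
  have h2 : ∏ j, Sum.elim q w (φ.orient j) = (∏ r ∈ φ.roots, q r) * ∏ e ∈ φ.edges, w e := by
    have : φ.roots.disjSum φ.edges = Finset.univ.image φ.orient := by
      ext x
      rw [← Finset.mem_coe, ← range_orient φ]
      simp
    rw [← Finset.prod_image (g := φ.orient) (f := Sum.elim q w)
      fun i _ j _ h => orient_injective φ h, ← this, Finset.prod_disjSum]
    simp
  rw [h1, Matrix.det_mul_row, Matrix.det_conjTranspose, mul_assoc, det_submatrix_orient φ hθ,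
    det_matrix φ hθ, star_prod, ← Finset.prod_mul_distrib, weight, ← h2]
  simp only [star_one_sub_exp_mul]
  push_cast
  rfl

end

/-! ### Summation over forests and Cramer's rule. -/

/-- Cauchy-Binet expansion of the determinant of `coincidence * B` over the forests. -/
theorem det_coincidence_mul_eq_sum {V : Type*} [Fintype V] [DecidableEq V] {G : SimpleGraph V}
    (w : Sym2 V → ℝ) (θ : V → V → ℝ) (q : V → ℝ) (B : Matrix (V ⊕ Sym2 V) V ℂ) :
    (coincidence G w θ q * B).det = ∑ φ : RootedMTSF G,
      ((coincidence G w θ q).submatrix id φ.orient).det * (B.submatrix φ.orient id).det := by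
  classical
  have h : ∀ φ : RootedMTSF G, ((coincidence G w θ q).submatrix id φ.orient).det *
      (B.submatrix φ.orient id).det = ∑ f : V → V ⊕ Sym2 V,
        if ∀ v, f v ∈ Set.range φ.orient then
          (∏ v, coincidence G w θ q v (f v)) * (B.submatrix f id).det else 0 := by
    intro φ
    rw [← sum_range_subset_eq_det_mul_det _ _ (orient_injective φ), Finset.sum_filter]
  simp only [h]
  rw [Finset.sum_comm, det_mul_eq_sum]
  refine Finset.sum_congr rfl fun f _ => ?_
  -- A nonzero term forces `f` to be injective (no equal rows) and each `f v` to be incident to `v`.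
  -- Then `f` takes values in the range of exactly one forest and is counted once.
  by_cases hf : (∏ v, coincidence G w θ q v (f v)) * (B.submatrix f id).det = 0
  · simp [hf]
  obtain ⟨h1, h2⟩ := mul_ne_zero_iff.1 hf
  have hinj : Function.Injective f := by
    intro u v huv
    by_contra hne
    exact h2 (Matrix.det_zero_of_row_eq hne (by ext j; simp [huv]))
  have hinc : ∀ v, incidence G θ (f v) v ≠ 0 := by
    intro v h0
    exact h1 (Finset.prod_eq_zero (Finset.mem_univ v) (by simp [coincidence, h0]))
  obtain ⟨φ, hφ⟩ := exists_rootedMTSF_of_injective (G := G) hinj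
    (fun v r hr => by
      have := hinc v
      rw [hr, incidence_inl] at this
      by_contra hne
      exact this (if_neg fun h => hne h.symm))
    (fun v e he => incidence_inr_ne_zero (he ▸ hinc v))
  have hrange : ∀ ψ : RootedMTSF G, (∀ v, f v ∈ Set.range ψ.orient) ↔ ψ = φ := by
    intro ψ
    rw [range_orient]
    constructor
    · intro h
      have hsub : Finset.univ.image f ⊆ ψ.roots.disjSum ψ.edges := by
        intro x hx
        obtain ⟨v, -, rfl⟩ := Finset.mem_image.1 hx
        exact h v
      -- Every forest has exactly as many roots and edges together as there are nodes, so inclusion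
      -- implies equality.
      have hcard : (ψ.roots.disjSum ψ.edges).card ≤ (Finset.univ.image f).card := by
        have : ψ.roots.disjSum ψ.edges = Finset.univ.image ψ.orient := by
          ext x
          rw [← Finset.mem_coe, ← range_orient ψ]
          simp
        rw [this, Finset.card_image_of_injective _ hinj]
        exact Finset.card_image_le
      have heq : φ.roots.disjSum φ.edges = ψ.roots.disjSum ψ.edges :=
        hφ.trans (Finset.eq_of_subset_of_card_le hsub hcard)
      refine RootedMTSF.ext ?_ ?_
      · simpa using (congrArg Finset.toRight heq).symm
      · simpa using (congrArg Finset.toLeft heq).symm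
    · rintro rfl v
      rw [hφ]
      simp
  simp only [hrange, Finset.sum_ite_eq', Finset.mem_univ, if_true]

variable {V : Type*} [Fintype V] [DecidableEq V] {G : SimpleGraph V} {w : Sym2 V → ℝ}
  {θ : V → V → ℝ} {q : V → ℝ}

/-- The matrix-forest theorem: the partition function is a determinant. -/
theorem det_magneticLaplacian_add (hθ : ∀ u v, G.Adj u v → θ v u = -θ u v) :
    (magneticLaplacian G w θ + Matrix.diagonal fun v => (q v : ℂ)).det =
      (partitionFunction G w θ q : ℂ) := by
  rw [← coincidence_mul_incidence w q hθ, det_coincidence_mul_eq_sum, partitionFunction]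
  push_cast
  exact Finset.sum_congr rfl fun φ _ => det_mul_det_eq_weight φ hθ

/-- Replacing a column of a product only replaces that column in the right factor, so the forest
expansion applies to Cramer's numerators as well. -/
theorem cramer_magneticLaplacian_add (hθ : ∀ u v, G.Adj u v → θ v u = -θ u v) (g : V → ℂ) :
    (magneticLaplacian G w θ + Matrix.diagonal fun v => (q v : ℂ)).cramer
        ((Matrix.diagonal fun v => (q v : ℂ)).mulVec g) =
      ∑ φ : RootedMTSF G, (weight w θ q φ : ℂ) • estimator θ g φ := by
  ext v
  have hd : (Matrix.diagonal fun v => (q v : ℂ)).mulVec g =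
      (coincidence G w θ q).mulVec (Sum.elim g 0) := by
    ext u
    rw [Matrix.mulVec_diagonal]
    simp [Matrix.mulVec, dotProduct, coincidence, incidence_inl]
  rw [Matrix.cramer_apply, hd, ← coincidence_mul_incidence w q hθ,
    ← Matrix.mul_updateCol, det_coincidence_mul_eq_sum, Finset.sum_apply]
  refine Finset.sum_congr rfl fun φ _ => ?_
  have h1 : ((incidence G θ).updateCol v (Sum.elim g 0)).submatrix φ.orient id =
      ((incidence G θ).submatrix φ.orient id).updateCol v
        (((incidence G θ).submatrix φ.orient id).mulVec (estimator θ g φ)) := by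
    ext i j
    have := incidence_mulVec_estimator hθ g φ (orient_mem φ i)
    simp only [Matrix.submatrix_apply, Matrix.updateCol_apply, id]
    split_ifs with hj
    · exact this.symm
    · rfl
  -- Cramer's rule in reverse for the forest's own system; adj(M) M = det M requires no
  -- invertibility, so forests of weight 0 need no separate treatment.
  rw [h1, ← Matrix.cramer_apply, Matrix.cramer_eq_adjugate_mulVec, Matrix.mulVec_mulVec,
    Matrix.adjugate_mul, Matrix.smul_mulVec, Matrix.one_mulVec, Pi.smul_apply, Pi.smul_apply,
    smul_eq_mul, smul_eq_mul, ← mul_assoc, det_mul_det_eq_weight φ hθ]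

end MagneticForest

theorem proposition1 {V : Type*} [Fintype V] [DecidableEq V] (G : SimpleGraph V)
    (w : Sym2 V → ℝ) (hw : ∀ e ∈ G.edgeSet, 0 < w e)
    (θ : V → V → ℝ) (hθ : ∀ u v, G.Adj u v → θ v u = -θ u v)
    (q : V → ℝ) (hq : ∀ v, 0 < q v) (g : V → ℂ)
    {Ω : Type*} [MeasurableSpace Ω] (P : Measure Ω)
    (φ : Ω → MagneticForest.RootedMTSF G)
    (hφ : HasLaw φ (MagneticForest.law hw θ hq).toMeasure P) :
    IsUnit (MagneticForest.magneticLaplacian G w θ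
      + Matrix.diagonal fun v => (q v : ℂ)).det ∧
    Integrable (fun ω => MagneticForest.estimator θ g (φ ω)) P ∧
    ∫ ω, MagneticForest.estimator θ g (φ ω) ∂P =
      Matrix.mulVec
        (MagneticForest.magneticLaplacian G w θ + Matrix.diagonal fun v => (q v : ℂ))⁻¹
        (Matrix.mulVec (Matrix.diagonal fun v => (q v : ℂ)) g) := by
  have hZ := MagneticForest.partitionFunction_pos hw θ hq
  have hdet := MagneticForest.det_magneticLaplacian_add (w := w) (q := q) hθ
  refine ⟨?_, ?_, ?_⟩
  · rw [hdet, isUnit_iff_ne_zero]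
    exact_mod_cast hZ.ne'
  · have h : Integrable (MagneticForest.estimator θ g) (P.map φ) := by
      rw [hφ.map_eq]
      exact .of_finite
    exact h.comp_aemeasurable hφ.aemeasurable
  · have h := hφ.integral_comp (f := MagneticForest.estimator θ g)
      (Integrable.of_finite).aestronglyMeasurable
    refine Eq.trans h ?_
    -- The inverse is the adjugate over the determinant Z, so the normalization of the law is
    -- exactly Cramer's denominator.
    rw [PMF.integral_eq_sum, Matrix.inv_def, Matrix.smul_mulVec,
      ← Matrix.cramer_eq_adjugate_mulVec, MagneticForest.cramer_magneticLaplacian_add hθ g, hdet,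
      Ring.inverse_eq_inv', Finset.smul_sum]
    refine Finset.sum_congr rfl fun ψ _ => ?_
    rw [MagneticForest.law, PMF.ofFintype_apply, ENNReal.toReal_ofReal
      (div_nonneg (MagneticForest.weight_nonneg hw θ hq ψ) hZ.le), smul_smul]
    ext v
    simp only [Pi.smul_apply, Complex.real_smul, smul_eq_mul]
    push_cast
    ring
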